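/- Corollary 5.1. Let $F$ be a number field with ring of integers $O_F$. An Arakelov divisor is a formal sum $D=\sum_P x_P P+\sum_\sigma x_\sigma\sigma$, where $P$ runs over the maximal ideals of $O_F$, $x_P\in\mathbb Z$ is zero for almost all $P$, $\sigma$ runs over the infinite places of $F$, and $x_\sigma\in\mathbb R$. Let $I=\prod_P P^{-x_P}$ be its fractional ideal, embedded as a lattice in $I\otimes\mathbb R=F\otimes_{\mathbb Q}\mathbb R=\prod_\sigma F_\sigma$. For $z=(z_\sigma)\in F\otimes\mathbb R$ put $$\|z\|_D^2=\sum_{\sigma\text{ real}}|z_\sigma|^2e^{-2x_\sigma}+\sum_{\sigma\text{ complex}}|z_\sigma|^2\cdot 2e^{-x_\sigma},\qquad u_D(z)=e^{-\pi\|z\|_D^2}.$$ Ghost-spaces. For a locally compact abelian group $G$ and a continuous, strictly positive, positive-definite function $u:G\to\mathbb R$ with $u(0)=1$, the ghost-space of the first kind $G_u$ is $G$ with the convolution $\delta_x*\delta_y=\frac{u(x)u(y)}{u(x+y)}\delta_{x+y}$; it is finite-dimensional with respect to a Haar measure $m$ if $u$ is $m$-integrable, and then $\dim_m G_u=\log\int_G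 u\,dm$. If $G$ is discrete, $\dim G_u$ is taken with $m$ the counting measure. For an even, positive-definite probability measure $\mu$ on $G$ (positive-definite: $\int_G (f*\tilde f)\,d\mu\ge 0$ for all $f\in C_c(G)$, where $\tilde f(x)=\overline{f(-x)}$), the ghost-space of the second kind $G^\mu$ is $G$ with the convolution $\delta_x*\delta_y=T_{x+y}\mu$, where $T_{x+y}$ is the shift by $x+y$; if $G$ is compact with Haar probability measure $m$, and $\mu=f\cdot m$ with $f\ge 0$ continuous and $f(0)>0$, then $G^\mu$ is finite-dimensional and $\dim G^\mu=\log f(0)$. For a closed subgroup $H\subseteq G$ with Haar measure $m_H$, the quotient $G_u/H_u$ is $(G/H)_v$ with $v(x+H)=\int_H u(x+y)\,dm_H(y)\big/\int_H u\,dm_H$, and the quotient $G/G_u$ is $G^\mu$ with $\mu$ the probability measure proportional to $u$ times a Haar measure of $G$. Cohomology. Put $$H^0(D)=I_{u_D},\qquad H^1(D)=\big((I\otimes\mathbb R)/I\big)\big/\big((I\otimes\mathbb R)_{u_D}/I_{u_D}\big),$$ and $h^i(D)=\dim H^i(D)$. Thus $$h^0(D)=\log\sum_{x\in I}e^{-\pi\|x\|_D^2},$$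 and $h^1(D)$ is the logarithm of the value at $0$ of the continuous density, with respect to the Haar probability measure of $(F\otimes\mathbb R)/I$, of the probability measure on $(F\otimes\mathbb R)/I$ whose density is proportional to $\overline x\mapsto\sum_{y\in I}e^{-\pi\|x+y\|_D^2}$. Let $K$ be the canonical Arakelov divisor: its fractional ideal is the inverse $\partial^{-1}$ of the different of $F$, and its infinite components are zero. Then for every Arakelov divisor $D$ the ghost-spaces $H^0(K-D)$ (of the first kind) and $H^1(D)$ (of the second kind) are well defined, including the ghost-spaces of the first kind $(I\otimes\mathbb R)_{u_D}$, $I_{u_D}$ (which is finite-dimensional) and $(I\otimes\mathbb R)_{u_D}/I_{u_D}$ used to form $H^1(D)$; both are finite-dimensional, and $$h^1(D)=h^0(K-D).$$ -/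

import Mathlib

open MeasureTheory NumberField IsDedekindDomain
open scoped nonZeroDivisors ENNReal ComplexOrder

noncomputable section

namespace Ghost

section Definitions

variable {G : Type*} [AddCommGroup G]

/-- A complex function on an abelian group is positive-definite if all the matrices
`(f (x j - x i))` are hermitian and nonnegative-definite. -/
def PosDefFun (f : G → ℂ) : Prop :=
  ∀ (n : ℕ) (x : Fin n → G), (Matrix.of fun i j => f (x j - x i)).PosSemidef

variable [TopologicalSpace G]

/-- The functions `u` that define a ghost-space of the first kind `G_u`, that is, the group `G`
with the convolution `δ_x * δ_y = (u x * u y / u (x + y)) • δ_(x + y)`. The ghost-space is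
determined by `u`, and `u` by the convolution, so `G_u` is represented by `u`. -/
structure IsFirstKind (u : G → ℝ) : Prop where
  pos : ∀ x, 0 < u x
  map_zero : u 0 = 1
  continuous : Continuous u
  posDef : PosDefFun fun x => (u x : ℂ)

variable [MeasurableSpace G]

/-- A measure `μ` is positive-definite if `∫ (f * f~) dμ ≥ 0` for all continuous compactly
supported complex functions `f`, where `f~ x = conj (f (-x))` and the convolution
`(f * f~) x = ∫ f y * conj (f (y - x)) dm y` is taken with respect to a Haar measure `m`. -/
def PosDefMeasure (μ : Measure G) : Prop :=
  ∀ (m : Measure G) [m.IsAddHaarMeasure] (f : G → ℂ), Continuous f → HasCompactSupport f →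
    0 ≤ ∫ x, (∫ y, f y * starRingEnd ℂ (f (y - x)) ∂m) ∂μ

/-- The measures `μ` that define a ghost-space of the second kind `G^μ`, that is, the group `G`
with the convolution `δ_x * δ_y = T_(x + y) μ`. The ghost-space is determined by `μ`, and `μ`
by the convolution, so `G^μ` is represented by `μ`. -/
structure IsSecondKind (μ : Measure G) : Prop where
  isProbability : IsProbabilityMeasure μ
  even : μ.map (fun x => -x) = μ
  posDef : PosDefMeasure μ

/-- `G_u` has finite dimension with respect to the Haar measure `m`. -/
def FiniteDimFirst (m : Measure G) (u : G → ℝ) : Prop := Integrable u m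

/-- The dimension of `G_u` with respect to the Haar measure `m`. -/
def dimFirst (m : Measure G) (u : G → ℝ) : ℝ := Real.log (∫ x, u x ∂m)

/-- The absolute dimension of `G_u` for discrete `G`: the Haar measure is the counting measure. -/
def absDimFirst [DiscreteTopology G] (u : G → ℝ) : ℝ := dimFirst Measure.count u

/-- `f` is a continuous density of `μ` with respect to `m`. There is at most one if `m` is a Haar
measure, see `IsDensity.unique`; it gives a meaning to the value of the density at a point. -/
structure IsDensity (m μ : Measure G) (f : G → ℝ) : Prop where
  continuous : Continuous f
  nonneg : ∀ x, 0 ≤ f x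
  eq_withDensity : μ = m.withDensity fun x => ENNReal.ofReal (f x)

theorem IsDensity.unique {G : Type*} [TopologicalSpace G] [MeasurableSpace G] [OpensMeasurableSpace G] {m μ : Measure G} [m.IsOpenPosMeasure]
    [SigmaFinite m] {f g : G → ℝ} (hf : IsDensity m μ f) (hg : IsDensity m μ g) : f = g := by
  have h : (fun x => ENNReal.ofReal (f x)) =ᵐ[m] fun x => ENNReal.ofReal (g x) :=
    (withDensity_eq_iff_of_sigmaFinite
      (ENNReal.measurable_ofReal.comp hf.continuous.measurable).aemeasurable
      (ENNReal.measurable_ofReal.comp hg.continuous.measurable).aemeasurable).1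
      (hf.eq_withDensity ▸ hg.eq_withDensity)
  refine (Continuous.ae_eq_iff_eq m hf.continuous hg.continuous).1 ?_
  filter_upwards [h] with x hx
  exact (ENNReal.ofReal_eq_ofReal_iff (hf.nonneg x) (hg.nonneg x)).1 hx

/-- `G^μ` has finite dimension with respect to the Haar measure `m`. -/
def FiniteDimSecond (m μ : Measure G) : Prop := ∃ f, IsDensity m μ f ∧ 0 < f 0

open scoped Classical in
/-- The dimension of `G^μ` with respect to the Haar measure `m`: the logarithm of the value at `0`
of the density of `μ` with respect to `m`. -/
def dimSecond (m μ : Measure G) : ℝ :=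
  if h : ∃ f, IsDensity m μ f then Real.log (h.choose 0) else 0

/-- The Haar probability measure of a compact group. -/
def haarProb (G : Type*) [AddCommGroup G] [TopologicalSpace G] [IsTopologicalAddGroup G]
    [CompactSpace G] [MeasurableSpace G] [BorelSpace G] : Measure G :=
  Measure.addHaarMeasure ⊤

/-- The absolute dimension of `G^μ` for compact `G`: the Haar measure is the probability one. -/
def absDimSecond [IsTopologicalAddGroup G] [CompactSpace G] [BorelSpace G]
    (μ : Measure G) : ℝ := dimSecond (haarProb G) μ

/-- The quotient `G / G_u` is the ghost-space of the second kind `G^μ`, where `μ` is the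
probability measure proportional to `u • m`, for a Haar measure `m` on `G`. -/
def quotientMeasure (m : Measure G) (u : G → ℝ) : Measure G :=
  (∫⁻ x, ENNReal.ofReal (u x) ∂m)⁻¹ • m.withDensity fun x => ENNReal.ofReal (u x)

instance (H : AddSubgroup G) [MeasurableAdd G] : MeasurableAdd H where
  measurable_const_add c := (measurable_subtype_coe.const_add (c : G)).subtype_mk
  measurable_add_const c := (measurable_subtype_coe.add_const (c : G)).subtype_mk

/-- The quotient `G_u / H_u` is the ghost-space of the first kind `(G / H)_v`, where
`v (x + H) = (∫_H u (x + y) dm y) / (∫_H u y dm y)` for a Haar measure `m` on `H`. -/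
def quotientFun [MeasurableAdd G] (H : AddSubgroup G) (m : Measure H) [m.IsAddLeftInvariant]
    (u : G → ℝ) : G ⧸ H → ℝ :=
  Quotient.lift (fun x : G => (∫ y : H, u (x + y) ∂m) / ∫ y : H, u y ∂m) (by
    intro a b hab
    have hab' : -a + b ∈ H := QuotientAddGroup.leftRel_apply.1 hab
    have h := integral_add_left_eq_self (μ := m) (fun y : H => u (a + y)) ⟨-a + b, hab'⟩
    have h' : ∀ y : H, u (a + ((⟨-a + b, hab'⟩ + y : H) : G)) = u (b + y) := fun y => by
      congr 1
      push_cast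
      abel
    simp only [h'] at h
    simp only [h])

end Definitions

end Ghost

/-- An Arakelov divisor `∑ x_P P + ∑ x_σ σ` on the number field `F`: integer coefficients, almost
all zero, at the maximal ideals of `𝓞 F`, and real coefficients at the infinite places. -/
abbrev ArakelovDivisor (F : Type*) [Field F] [NumberField F] : Type _ :=
  (HeightOneSpectrum (𝓞 F) →₀ ℤ) × (InfinitePlace F → ℝ)

namespace ArakelovDivisor

open Ghost

variable {F : Type*} [Field F] [NumberField F]

/-- The fractional ideal `I = ∏ P ^ (-x_P)` of an Arakelov divisor. -/
def ideal (D : ArakelovDivisor F) : (FractionalIdeal (𝓞 F)⁰ F)ˣ :=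
  D.1.prod fun P n =>
    (Units.mk0 (P.asIdeal : FractionalIdeal (𝓞 F)⁰ F)
      (FractionalIdeal.coeIdeal_ne_zero.mpr P.ne_bot)) ^ (-n)

/-- The fractional ideal `I` as a subgroup of `I ⊗ ℝ = F ⊗ ℝ = ∏_σ F_σ`. -/
abbrev lattice (D : ArakelovDivisor F) : AddSubgroup (mixedEmbedding.mixedSpace F) :=
  (mixedEmbedding.idealLattice F D.ideal).toAddSubgroup

instance (D : ArakelovDivisor F) : DiscreteTopology D.lattice :=
  inferInstanceAs (DiscreteTopology (mixedEmbedding.idealLattice F D.ideal))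

open scoped Classical in
instance (D : ArakelovDivisor F) : CompactSpace (mixedEmbedding.mixedSpace F ⧸ D.lattice) := by
  refine ⟨?_⟩
  rw [← (QuotientAddGroup.mk_surjective (s := D.lattice)).range_eq]
  refine IsZLattice.isCompact_range_of_periodic (mixedEmbedding.idealLattice F D.ideal) _
    QuotientAddGroup.continuous_mk fun z w hw => ?_
  exact (QuotientAddGroup.mk_add_of_mem z hw)

instance (D : ArakelovDivisor F) :
    IsClosed (D.lattice : Set (mixedEmbedding.mixedSpace F)) :=
  AddSubgroup.isClosed_of_discrete

open scoped Classical in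
/-- The square of the hermitian norm `‖z‖_D` on `F ⊗ ℝ`. -/
def normSq (D : ArakelovDivisor F) (z : mixedEmbedding.mixedSpace F) : ℝ :=
  ∑ σ : {w : InfinitePlace F // w.IsReal}, |z.1 σ| ^ 2 * Real.exp (-2 * D.2 σ) +
    ∑ σ : {w : InfinitePlace F // w.IsComplex}, ‖z.2 σ‖ ^ 2 * (2 * Real.exp (-D.2 σ))

/-- The function `u x = exp (-π ‖x‖_D ^ 2)` on `F ⊗ ℝ`. -/
def gaussian (D : ArakelovDivisor F) (z : mixedEmbedding.mixedSpace F) : ℝ :=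
  Real.exp (-Real.pi * D.normSq z)

/-- `H⁰(D) = I_u`, a ghost-space of the first kind. -/
def H0 (D : ArakelovDivisor F) : D.lattice → ℝ := fun x => D.gaussian x

/-- `h⁰(D) = dim H⁰(D)`. -/
def h0 (D : ArakelovDivisor F) : ℝ := absDimFirst D.H0

/-- The ghost-space of the first kind `(I ⊗ ℝ)_u / I_u = ((I ⊗ ℝ) / I)_v`. -/
def cechQuotient (D : ArakelovDivisor F) : mixedEmbedding.mixedSpace F ⧸ D.lattice → ℝ :=
  quotientFun D.lattice Measure.count D.gaussian

/-- `H¹(D) = ((I ⊗ ℝ) / I) / ((I ⊗ ℝ)_u / I_u)`, a ghost-space of the second kind. -/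
def H1 (D : ArakelovDivisor F) : Measure (mixedEmbedding.mixedSpace F ⧸ D.lattice) :=
  quotientMeasure (haarProb _) D.cechQuotient

/-- `h¹(D) = dim H¹(D)`. -/
def h1 (D : ArakelovDivisor F) : ℝ := absDimSecond D.H1

variable (F) in
/-- The canonical Arakelov divisor: its fractional ideal is the inverse of the different, see
`ideal_canonical`, and its infinite components are zero. -/
def canonical : ArakelovDivisor F :=
  (Finsupp.ofSupportFinite
    (fun P => FractionalIdeal.count F P (differentIdeal ℤ (𝓞 F) : FractionalIdeal (𝓞 F)⁰ F))
    (FractionalIdeal.finite_factors _), 0)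

variable (F) in
theorem ideal_canonical :
    ((canonical F).ideal : FractionalIdeal (𝓞 F)⁰ F) =
      (differentIdeal ℤ (𝓞 F) : FractionalIdeal (𝓞 F)⁰ F)⁻¹ := by
  have h0 : (differentIdeal ℤ (𝓞 F) : FractionalIdeal (𝓞 F)⁰ F) ≠ 0 :=
    FractionalIdeal.coeIdeal_ne_zero.mpr differentIdeal_ne_bot
  rw [← FractionalIdeal.finprod_heightOneSpectrum_factorization' F (inv_ne_zero h0),
    finprod_eq_finsetProd_of_mulSupport_subset (s := (canonical F).1.support)]
  · simp only [ideal, Finsupp.prod, Units.coe_prod, Units.val_zpow_eq_zpow_val, Units.val_mk0,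
      FractionalIdeal.count_inv]
    rfl
  · intro P hP
    simp only [Function.mem_mulSupport, FractionalIdeal.count_inv] at hP
    simp only [Finset.mem_coe, Finsupp.mem_support_iff]
    intro h
    apply hP
    have h' : FractionalIdeal.count F P
        (differentIdeal ℤ (𝓞 F) : FractionalIdeal (𝓞 F)⁰ F) = 0 := h
    rw [h', neg_zero, zpow_zero]

end ArakelovDivisor

end

/-!
The density of `H¹(D)` on the torus `(F ⊗ ℝ) / I` is the periodized Gaussian of `D`, normalized to
have integral `1`, and its value at `0` is the sum of its Fourier coefficients. The characters of
the torus are given, through the trace form on `F ⊗ ℝ`, by the dual lattice of `I`, which is the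
lattice of `K - D` because the inverse different is dual to `𝓞 F`. The Fourier coefficient of the
periodization at a dual lattice point is the Fourier transform of the Gaussian of `D` there, and
this is, up to the normalizing constant, the Gaussian of `K - D`. In particular the coefficients
are nonnegative and summable, so the periodized Gaussian and `H¹(D)` are positive-definite.
-/

noncomputable section

namespace Ghost

section PositiveDefinite

variable {G H : Type*} [AddCommGroup G] [AddCommGroup H]

theorem coe_addChar_neg (χ : AddChar G Circle) (x : G) :
    (χ (-x) : ℂ) = starRingEnd ℂ (χ x : ℂ) := by
  rw [AddChar.map_neg_eq_inv, Circle.coe_inv_eq_conj]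

theorem coe_addChar_sub (χ : AddChar G Circle) (x y : G) :
    (χ (x - y) : ℂ) = χ x * starRingEnd ℂ (χ y : ℂ) := by
  rw [sub_eq_add_neg, AddChar.map_add_eq_mul, Circle.coe_mul, coe_addChar_neg]

theorem posDefFun_addChar (χ : AddChar G Circle) : PosDefFun fun x => (χ x : ℂ) := by
  intro n x
  convert Matrix.posSemidef_vecMulVec_star_self fun i => (χ (x i) : ℂ) using 1
  ext i j
  simp only [Matrix.of_apply, Matrix.vecMulVec_apply, Pi.star_apply, coe_addChar_sub, mul_comm,
    starRingEnd_apply]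

theorem PosDefFun.comp {f : G → ℂ} (hf : PosDefFun f) (φ : H →+ G) :
    PosDefFun fun x => f (φ x) := by
  intro n x
  simpa only [map_sub] using hf n fun i => φ (x i)

theorem PosDefFun.const_mul {f : G → ℂ} (hf : PosDefFun f) {c : ℂ} (hc : 0 ≤ c) :
    PosDefFun fun x => c * f x :=
  fun n x => (hf n x).smul hc

theorem PosDefFun.apply_neg {f : G → ℂ} (hf : PosDefFun f) (x : G) :
    f (-x) = starRingEnd ℂ (f x) := by
  simpa using ((hf 2 ![0, x]).isHermitian.apply 1 0).symm

theorem PosDefFun.integral {α : Type*} [MeasurableSpace α] {ν : Measure α} {f : α → G → ℂ}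
    (hf : ∀ a, PosDefFun (f a)) (hint : ∀ x, Integrable (fun a => f a x) ν) :
    PosDefFun fun x => ∫ a, f a x ∂ν := by
  intro n x
  refine Matrix.PosSemidef.of_dotProduct_mulVec_nonneg (Matrix.IsHermitian.ext fun i j => ?_)
    fun c => ?_
  · simp only [Matrix.of_apply, ← starRingEnd_apply, ← integral_conj, ← (hf _).apply_neg, neg_sub]
  · have hint' : ∀ i j, Integrable (fun a => star (c i) * (f a (x j - x i) * c j)) ν := fun i j =>
      ((hint _).mul_const _).const_mul _
    have h : star c ⬝ᵥ (Matrix.of fun i j => ∫ a, f a (x j - x i) ∂ν).mulVec c =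
        ∫ a, star c ⬝ᵥ (Matrix.of fun i j => f a (x j - x i)).mulVec c ∂ν := by
      simp only [dotProduct, Matrix.mulVec, Matrix.of_apply, Pi.star_apply, Finset.mul_sum]
      rw [integral_finsetSum _ fun i _ => integrable_finsetSum _ fun j _ => hint' i j]
      simp_rw [integral_finsetSum _ fun j _ => hint' _ j, integral_const_mul, integral_mul_const]
    rw [h]
    exact integral_nonneg fun a => (hf a n x).dotProduct_mulVec_nonneg c

theorem integral_count_of_summable {ι : Type*} [Countable ι] [MeasurableSpace ι]
    [MeasurableSingletonClass ι] {E : Type*} [NormedAddCommGroup E] [NormedSpace ℝ E]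
    [CompleteSpace E] {f : ι → E}
    (hf : Summable fun i => ‖f i‖) : ∫ i, f i ∂Measure.count = ∑' i, f i := by
  simp [integral_countable (integrable_count_iff.2 hf)]

theorem PosDefFun.of_hasSum {ι : Type*} [Countable ι] {f : ι → G → ℂ} {g : G → ℂ}
    (hf : ∀ i, PosDefFun (f i)) (hg : ∀ x, HasSum (fun i => f i x) (g x)) : PosDefFun g := by
  let _ : MeasurableSpace ι := ⊤
  have hint : ∀ x, Integrable (fun i => f i x) Measure.count := fun x =>
    integrable_count_iff.2 (hg x).summable.norm
  convert PosDefFun.integral hf hint with x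
  rw [integral_count_of_summable (hg x).summable.norm, (hg x).tsum_eq]

variable [TopologicalSpace G] [TopologicalSpace H]

theorem IsFirstKind.comp {u : G → ℝ} (hu : IsFirstKind u) (φ : H →+ G) (hφ : Continuous φ) :
    IsFirstKind fun x => u (φ x) where
  pos x := hu.pos (φ x)
  map_zero := (congrArg u φ.map_zero).trans hu.map_zero
  continuous := hu.continuous.comp hφ
  posDef := hu.posDef.comp φ

theorem IsFirstKind.apply_neg {u : G → ℝ} (hu : IsFirstKind u) (x : G) : u (-x) = u x := by
  simpa only [Complex.conj_ofReal, Complex.ofReal_inj] using hu.posDef.apply_neg x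

end PositiveDefinite

section Dimension

variable {G : Type*} [AddCommGroup G] [TopologicalSpace G] [MeasurableSpace G]
  {m : Measure G} [m.IsOpenPosMeasure]

theorem IsFirstKind.integral_pos {v : G → ℝ} (hv : IsFirstKind v) (hint : FiniteDimFirst m v) :
    0 < ∫ x, v x ∂m :=
  integral_pos_of_integrable_nonneg_nonzero hv.continuous hint (fun x => (hv.pos x).le)
    (hv.pos 0).ne'

variable [OpensMeasurableSpace G]

theorem IsFirstKind.isDensity_quotientMeasure {v : G → ℝ} (hv : IsFirstKind v)
    (hint : FiniteDimFirst m v) :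
    IsDensity m (quotientMeasure m v) fun x => v x / ∫ y, v y ∂m where
  continuous := hv.continuous.div_const _
  nonneg x := div_nonneg (hv.pos x).le (hv.integral_pos hint).le
  eq_withDensity := by
    rw [quotientMeasure, ← ofReal_integral_eq_lintegral_ofReal hint (.of_forall fun x =>
      (hv.pos x).le), ← withDensity_smul _ (by have := hv.continuous; fun_prop)]
    congr 1 with x
    rw [Pi.smul_apply, smul_eq_mul, ENNReal.ofReal_div_of_pos (hv.integral_pos hint), mul_comm,
      div_eq_mul_inv]

theorem IsFirstKind.isProbabilityMeasure_quotientMeasure {v : G → ℝ} (hv : IsFirstKind v)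
    (hint : FiniteDimFirst m v) : IsProbabilityMeasure (quotientMeasure m v) := by
  have h := hv.isDensity_quotientMeasure hint
  constructor
  rw [h.eq_withDensity, withDensity_apply _ .univ, Measure.restrict_univ,
    ← ofReal_integral_eq_lintegral_ofReal (hint.div_const _) (.of_forall h.nonneg), integral_div,
    div_self (hv.integral_pos hint).ne', ENNReal.ofReal_one]

theorem dimSecond_eq [SigmaFinite m] {μ : Measure G} {f : G → ℝ} (hf : IsDensity m μ f) :
    dimSecond m μ = Real.log (f 0) := by
  have h : ∃ f, IsDensity m μ f := ⟨f, hf⟩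
  rw [dimSecond, dif_pos h, h.choose_spec.unique hf]

theorem IsFirstKind.finiteDimSecond_quotientMeasure {v : G → ℝ} (hv : IsFirstKind v)
    (hint : FiniteDimFirst m v) : FiniteDimSecond m (quotientMeasure m v) :=
  ⟨_, hv.isDensity_quotientMeasure hint, div_pos (hv.pos 0) (hv.integral_pos hint)⟩

end Dimension

section Character

variable {G W : Type*} [AddCommGroup G] [TopologicalSpace G]

/-- A continuous character as a continuous complex function. -/
def character {χ : AddChar G Circle} (hχ : Continuous χ) : C(G, ℂ) :=
  ⟨fun x => (χ x : ℂ), continuous_subtype_val.comp hχ⟩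

theorem character_apply {χ : AddChar G Circle} (hχ : Continuous χ) (x : G) :
    character hχ x = χ x := rfl

/-- `χ` identifies `W` with a point-separating group of continuous characters of `G`. For a compact
group `G` this is, by Pontryagin duality, the group of all continuous characters. -/
structure IsPontryaginDual [AddCommGroup W] (χ : AddChar W (AddChar G Circle)) : Prop where
  continuous : ∀ w, Continuous (χ w)
  injective : Function.Injective χ
  separates : ∀ x, (∀ w, χ w x = 1) → x = 0

variable [AddCommGroup W] {χ : AddChar W (AddChar G Circle)}

theorem IsPontryaginDual.adjoin_character_eq_span (hχ : IsPontryaginDual χ) :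
    Subalgebra.toSubmodule (Algebra.adjoin ℂ (Set.range fun w => character (hχ.continuous w))) =
      Submodule.span ℂ (Set.range fun w => character (hχ.continuous w)) := by
  refine Algebra.adjoin_eq_span_of_subset _ (Set.Subset.trans ?_ Submodule.subset_span)
  intro g hg
  refine Submonoid.closure_induction (fun _ => id) ⟨0, ?_⟩ ?_ hg
  · ext x
    simp [character_apply]
  · rintro - - - - ⟨w, rfl⟩ ⟨w', rfl⟩
    exact ⟨w + w', by ext x; simp [character_apply, AddChar.map_add_eq_mul]⟩

theorem IsPontryaginDual.dense_span_character [CompactSpace G] (hχ : IsPontryaginDual χ) :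
    Dense (Submodule.span ℂ (Set.range fun w => character (hχ.continuous w)) : Set C(G, ℂ)) := by
  let A : StarSubalgebra ℂ C(G, ℂ) :=
    { toSubalgebra := Algebra.adjoin ℂ (Set.range fun w => character (hχ.continuous w))
      star_mem' := by
        change Algebra.adjoin ℂ _ ≤ star (Algebra.adjoin ℂ _)
        refine Algebra.adjoin_le ?_
        rintro - ⟨w, rfl⟩
        refine Algebra.subset_adjoin ⟨-w, ContinuousMap.ext fun x => ?_⟩
        rw [character_apply, ContinuousMap.star_apply, AddChar.map_neg_eq_inv, AddChar.inv_apply,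
          coe_addChar_neg, starRingEnd_apply, character_apply] }
  have hA : A.SeparatesPoints := by
    intro x y hxy
    contrapose! hxy
    refine sub_eq_zero.1 (hχ.separates _ fun w => ?_)
    rw [AddChar.map_sub_eq_div, div_eq_one]
    exact Subtype.ext (hxy _ ⟨_, Algebra.subset_adjoin ⟨w, rfl⟩, rfl⟩)
  have htop := ContinuousMap.starSubalgebra_topologicalClosure_eq_top_of_separatesPoints A hA
  rw [← hχ.adjoin_character_eq_span, dense_iff_closure_eq]
  exact congrArg (fun B : StarSubalgebra ℂ C(G, ℂ) => (B : Set C(G, ℂ))) htop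

end Character

section CompactGroup

theorem map_neg_withDensity {G : Type*} [AddCommGroup G] [MeasurableSpace G] [MeasurableNeg G]
    {m : Measure G} [m.IsNegInvariant] {f : G → ℝ≥0∞} (hf : Measurable f)
    (hf_neg : ∀ x, f (-x) = f x) : (m.withDensity f).map (fun x => -x) = m.withDensity f := by
  ext s hs
  rw [Measure.map_apply measurable_neg hs, withDensity_apply _ hs,
    withDensity_apply _ (measurable_neg hs)]
  simpa only [hf_neg] using (Measure.measurePreserving_neg m).setLIntegral_comp_preimage hs hf

theorem integral_addChar_eq_zero {G : Type*} [AddCommGroup G] [MeasurableSpace G]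
    [MeasurableAdd G] {μ : Measure G} [μ.IsAddLeftInvariant] {χ : AddChar G Circle} (hχ : χ ≠ 1) :
    ∫ x, (χ x : ℂ) ∂μ = 0 := by
  obtain ⟨a, ha⟩ := AddChar.ne_one_iff.1 hχ
  have h := integral_add_left_eq_self (μ := μ) (fun x => (χ x : ℂ)) a
  simp only [AddChar.map_add_eq_mul, Circle.coe_mul, integral_const_mul] at h
  exact (mul_left_eq_self₀.1 h).resolve_left fun e => ha (Circle.coe_eq_one.1 e)

section Functional

variable {X : Type*} [TopologicalSpace X] [CompactSpace X] [MeasurableSpace X]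
  [OpensMeasurableSpace X] {μ : Measure X} {φ : X → ℂ}

theorem integrable_continuousMap_mul (g : C(X, ℂ)) (hφ : Integrable φ μ) :
    Integrable (fun x => g x * φ x) μ :=
  hφ.bdd_mul g.continuous.aestronglyMeasurable (.of_forall g.norm_coe_le_norm)

/-- The functional `g ↦ ∫ g * φ dμ` on the continuous functions, for an integrable function `φ`. -/
def integralMulCLM (hφ : Integrable φ μ) : C(X, ℂ) →L[ℂ] ℂ :=
  LinearMap.mkContinuous
    { toFun := fun g => ∫ x, g x * φ x ∂μ
      map_add' := fun g g' => by
        simp only [ContinuousMap.add_apply, add_mul]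
        exact integral_add (integrable_continuousMap_mul g hφ) (integrable_continuousMap_mul g' hφ)
      map_smul' := fun c g => by
        simp only [ContinuousMap.smul_apply, smul_eq_mul, mul_assoc, integral_const_mul,
          RingHom.id_apply] }
    (∫ x, ‖φ x‖ ∂μ) fun g => by
      rw [mul_comm, ← integral_const_mul]
      refine norm_integral_le_of_norm_le (hφ.norm.const_mul _) (.of_forall fun x => ?_)
      rw [norm_mul]
      gcongr
      exact g.norm_coe_le_norm x

theorem integralMulCLM_apply (hφ : Integrable φ μ) (g : C(X, ℂ)) :
    integralMulCLM hφ g = ∫ x, g x * φ x ∂μ := rfl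

theorem integrable_continuousMap [IsFiniteMeasure μ] (g : C(X, ℂ)) : Integrable g μ :=
  g.continuous.integrable_of_hasCompactSupport (.of_compactSpace _)

end Functional

variable {G W : Type*} [AddCommGroup G] [TopologicalSpace G] [IsTopologicalAddGroup G]
  [CompactSpace G] [MeasurableSpace G] [BorelSpace G]

instance : IsProbabilityMeasure (haarProb G) :=
  ⟨Measure.addHaarMeasure_self (K₀ := (⊤ : TopologicalSpace.PositiveCompacts G))⟩

instance : (haarProb G).IsAddHaarMeasure := by
  unfold haarProb; infer_instance

instance : (haarProb G).IsNegInvariant := by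
  have : (haarProb G).Regular := by unfold haarProb; infer_instance
  infer_instance

section FourierSeries

variable [AddCommGroup W] {χ : AddChar W (AddChar G Circle)}

variable (χ) in
/-- The coefficient at `w` of the Fourier series of `f` in the characters `χ`. -/
def fourierCoefficient (f : G → ℂ) (w : W) : ℂ := ∫ x, (χ (-w) x : ℂ) * f x ∂haarProb G

open scoped Classical in
theorem IsPontryaginDual.fourierCoefficient_character (hχ : IsPontryaginDual χ) (w w' : W) :
    fourierCoefficient χ (character (hχ.continuous w')) w = if w' = w then 1 else 0 := by
  have h : ∀ x, (χ (-w) x : ℂ) * χ w' x = χ (w' - w) x := fun x => by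
    rw [sub_eq_neg_add, AddChar.map_add_eq_mul, AddChar.mul_apply, Circle.coe_mul]
  simp only [fourierCoefficient, character_apply, h]
  split_ifs with hw
  · simp [hw]
  · refine integral_addChar_eq_zero fun e => hw (sub_eq_zero.1 (hχ.injective ?_))
    rw [e, AddChar.map_zero_eq_one]

theorem IsPontryaginDual.ext_fourierCoefficient (hχ : IsPontryaginDual χ) {f g : C(G, ℂ)}
    (h : ∀ w, fourierCoefficient χ f w = fourierCoefficient χ g w) : f = g := by
  let d : C(G, ℂ) := f - g
  have hT : integralMulCLM (integrable_continuousMap (μ := haarProb G) d) = 0 := by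
    refine ContinuousLinearMap.ext_on hχ.dense_span_character ?_
    rintro - ⟨w, rfl⟩
    rw [zero_apply]
    have hw := sub_eq_zero.2 (h (-w))
    simp only [fourierCoefficient, neg_neg] at hw
    rw [← integral_sub] at hw
    · simpa only [integralMulCLM_apply, character_apply, d, ContinuousMap.sub_apply, mul_sub]
        using hw
    · exact integrable_continuousMap_mul (character (hχ.continuous w)) (integrable_continuousMap f)
    · exact integrable_continuousMap_mul (character (hχ.continuous w)) (integrable_continuousMap g)
  have hd : ∫ x, ‖d x‖ ^ 2 ∂haarProb G = 0 := by
    have h' : integralMulCLM (integrable_continuousMap (μ := haarProb G) d) (star d) = 0 := by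
      rw [hT, zero_apply]
    have hsq : ∀ x, (star d) x * d x = ((‖d x‖ ^ 2 : ℝ) : ℂ) := fun x => by
      rw [ContinuousMap.star_apply, ← starRingEnd_apply, Complex.conj_mul', Complex.ofReal_pow]
    simp only [integralMulCLM_apply, hsq, integral_complex_ofReal] at h'
    exact Complex.ofReal_eq_zero.1 h'
  by_contra hfg
  obtain ⟨x, hx⟩ := DFunLike.ne_iff.1 (sub_ne_zero.2 hfg)
  have hcont : Continuous fun x => ‖d x‖ ^ 2 := by fun_prop
  refine (hcont.integral_pos_of_hasCompactSupport_nonneg_nonzero (μ := haarProb G)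
    (.of_compactSpace _) (fun x => by positivity) (x := x) ?_).ne' hd
  simpa [d] using hx

theorem IsPontryaginDual.hasSum_fourierCoefficient (hχ : IsPontryaginDual χ) (f : C(G, ℂ))
    (hf : Summable fun w => ‖fourierCoefficient χ f w‖) :
    HasSum (fun w => fourierCoefficient χ f w • character (hχ.continuous w)) f := by
  have hs : Summable fun w => fourierCoefficient χ f w • character (hχ.continuous w) := by
    refine .of_norm_bounded hf fun w => ?_
    rw [norm_smul]
    refine mul_le_of_le_one_right (norm_nonneg _) ?_
    exact (ContinuousMap.norm_le _ zero_le_one).2 fun x => (Circle.norm_coe _).le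
  convert hs.hasSum
  refine hχ.ext_fourierCoefficient fun w => ?_
  classical
  let T := integralMulCLM (μ := haarProb G)
    (integrable_continuousMap (character (hχ.continuous (-w))))
  have hT : ∀ g : C(G, ℂ), T g = fourierCoefficient χ g w := fun g => by
    simp only [T, integralMulCLM_apply, fourierCoefficient, character_apply, mul_comm]
  have hw := hs.hasSum.mapL T
  simp only [map_smul] at hw
  simp only [hT, hχ.fourierCoefficient_character, smul_eq_mul, mul_ite, mul_one, mul_zero] at hw
  simpa using (hw.unique (hasSum_single w fun w' hw' => if_neg hw')).symm

end FourierSeries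

section PosDefMeasure

theorem integral_addChar_mul_autocorrelation [SecondCountableTopology G] {m h : Measure G}
    [IsFiniteMeasure m] [IsFiniteMeasure h] [h.IsAddLeftInvariant] [h.IsNegInvariant]
    {χ : AddChar G Circle} (hχ : Continuous χ) {φ : G → ℂ} (hφ : Continuous φ) :
    ∫ x, (χ x : ℂ) * (∫ y, φ y * starRingEnd ℂ (φ (y - x)) ∂m) ∂h =
      (∫ y, φ y * χ y ∂m) * starRingEnd ℂ (∫ x, φ x * χ x ∂h) := by
  simp_rw [← integral_const_mul]
  rw [integral_integral_swap_of_hasCompactSupport (by fun_prop) (.of_compactSpace _),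
    ← integral_mul_const]
  congr 1 with y
  rw [← integral_conj, ← integral_sub_left_eq_self _ h y, ← integral_const_mul]
  congr 1 with x
  rw [coe_addChar_sub, map_mul, sub_sub_cancel]
  ring

theorem posDefMeasure_withDensity_of_hasSum [SecondCountableTopology G] {p : W → ℝ}
    (hp : ∀ w, 0 ≤ p w) {χ : W → AddChar G Circle} (hχ : ∀ w, Continuous (χ w)) {f : G → ℝ}
    (hf : Continuous f) (hf0 : ∀ x, 0 ≤ f x)
    (hsum : HasSum (fun w => (p w : ℂ) • character (hχ w)) ⟨fun x => (f x : ℂ), by fun_prop⟩) :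
    PosDefMeasure ((haarProb G).withDensity fun x => ENNReal.ofReal (f x)) := by
  intro m _ φ hφ _
  set A : G → ℂ := fun x => ∫ y, φ y * starRingEnd ℂ (φ (y - x)) ∂m
  have hA : Integrable A (haarProb G) := by
    have hcont : Continuous fun z : G × G => φ z.2 * starRingEnd ℂ (φ (z.2 - z.1)) := by fun_prop
    exact (hcont.integrable_of_hasCompactSupport (μ := (haarProb G).prod m)
      (.of_compactSpace _)).integral_prod_left
  obtain ⟨c, hc⟩ : ∃ c : NNReal, m = c • haarProb G := ⟨_, Measure.isAddLeftInvariant_eq_smul m _⟩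
  have hchar : ∀ w, 0 ≤ integralMulCLM hA (character (hχ w)) := fun w => by
    simp only [integralMulCLM_apply, character_apply, A,
      integral_addChar_mul_autocorrelation (hχ w) hφ]
    rw [hc, integral_smul_nnreal_measure, NNReal.smul_def, Complex.real_smul, mul_assoc,
      Complex.mul_conj']
    exact_mod_cast mul_nonneg c.2 (sq_nonneg _)
  rw [integral_withDensity_eq_integral_toReal_smul (by fun_prop) (by simp)]
  simp only [ENNReal.toReal_ofReal (hf0 _), Complex.real_smul]
  refine (hsum.mapL (integralMulCLM hA)).nonneg fun w => ?_
  rw [map_smul, smul_eq_mul]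
  exact mul_nonneg (Complex.zero_le_real.2 (hp w)) (hchar w)

end PosDefMeasure

section FourierDual

variable [AddCommGroup W] {χ : AddChar W (AddChar G Circle)} {v : G → ℝ} {p : W → ℝ}

variable (χ) in
/-- The Fourier transform of the probability measure proportional to `v • haarProb G` is `p`, a
nonnegative summable function. -/
structure IsFourierDual (v : G → ℝ) (p : W → ℝ) : Prop where
  nonneg : ∀ w, 0 ≤ p w
  summable : Summable p
  coefficient : ∀ w, fourierCoefficient χ (fun x => (v x : ℂ)) w = p w * ∫ x, v x ∂haarProb G

theorem finiteDimFirst_haarProb (hv : Continuous v) : FiniteDimFirst (haarProb G) v :=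
  hv.integrable_of_hasCompactSupport (.of_compactSpace _)

theorem IsFourierDual.hasSum (h : IsFourierDual χ v p) (hχ : IsPontryaginDual χ)
    (hv : Continuous v) (hv0 : ∫ x, v x ∂haarProb G ≠ 0) :
    HasSum (fun w => (p w : ℂ) • character (hχ.continuous w))
      ⟨fun x => ((v x / ∫ y, v y ∂haarProb G : ℝ) : ℂ), by fun_prop⟩ := by
  set f : C(G, ℂ) := ⟨fun x => ((v x / ∫ y, v y ∂haarProb G : ℝ) : ℂ), by fun_prop⟩ with hf
  have hc : ∀ w, fourierCoefficient χ f w = p w := fun w => by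
    have hw := h.coefficient w
    simp only [fourierCoefficient] at hw
    simp only [fourierCoefficient, hf, ContinuousMap.coe_mk, Complex.ofReal_div, ← mul_div_assoc,
      integral_div, hw]
    exact mul_div_cancel_right₀ _ (Complex.ofReal_ne_zero.2 hv0)
  simp only [← hc]
  exact hχ.hasSum_fourierCoefficient f (by simpa [hc, abs_of_nonneg (h.nonneg _)] using h.summable)

theorem IsFourierDual.isFirstKind (h : IsFourierDual χ v p) (hχ : IsPontryaginDual χ)
    [Countable W] (hv : Continuous v) (hpos : ∀ x, 0 < v x) (hv_zero : v 0 = 1) :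
    IsFirstKind v where
  pos := hpos
  map_zero := hv_zero
  continuous := hv
  posDef := by
    have hint : 0 < ∫ x, v x ∂haarProb G :=
      hv.integral_pos_of_hasCompactSupport_nonneg_nonzero (.of_compactSpace _)
        (fun x => (hpos x).le) (hpos 0).ne'
    have hD : PosDefFun fun x => ((v x / ∫ y, v y ∂haarProb G : ℝ) : ℂ) :=
      PosDefFun.of_hasSum (fun w => (posDefFun_addChar (χ w)).const_mul
        (Complex.zero_le_real.2 (h.nonneg w))) fun x =>
          (h.hasSum hχ hv hint.ne').mapL (ContinuousMap.evalCLM ℂ x)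
    convert hD.const_mul (Complex.zero_le_real.2 hint.le) using 2 with x
    rw [← Complex.ofReal_mul, mul_div_cancel₀ _ hint.ne']

theorem IsFourierDual.isSecondKind_quotientMeasure [SecondCountableTopology G]
    (h : IsFourierDual χ v p) (hχ : IsPontryaginDual χ) (hv : IsFirstKind v) :
    IsSecondKind (quotientMeasure (haarProb G) v) := by
  have hint := finiteDimFirst_haarProb hv.continuous
  have hD := hv.isDensity_quotientMeasure hint
  refine ⟨hv.isProbabilityMeasure_quotientMeasure hint, ?_, ?_⟩ <;> rw [hD.eq_withDensity]
  · refine map_neg_withDensity hD.continuous.measurable.ennreal_ofReal fun x => ?_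
    rw [hv.apply_neg]
  · exact posDefMeasure_withDensity_of_hasSum h.nonneg hχ.continuous hD.continuous hD.nonneg
      (h.hasSum hχ hv.continuous (hv.integral_pos hint).ne')

theorem IsFourierDual.absDimSecond_quotientMeasure [TopologicalSpace W] [DiscreteTopology W]
    [MeasurableSpace W] [MeasurableSingletonClass W] [Countable W]
    (h : IsFourierDual χ v p) (hχ : IsPontryaginDual χ) (hv : IsFirstKind v) :
    absDimSecond (quotientMeasure (haarProb G) v) = absDimFirst p := by
  have hint := finiteDimFirst_haarProb hv.continuous
  have h0 : HasSum p (v 0 / ∫ x, v x ∂haarProb G) := by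
    have := (h.hasSum hχ hv.continuous (hv.integral_pos hint).ne').mapL
      (ContinuousMap.evalCLM ℂ 0)
    simpa [character_apply, ← Complex.ofReal_div, Complex.hasSum_ofReal] using this
  rw [absDimSecond, dimSecond_eq (hv.isDensity_quotientMeasure hint), ← h0.tsum_eq, absDimFirst,
    dimFirst, integral_count_of_summable h.summable.norm]

end FourierDual

end CompactGroup

section LiftCharacter

variable {V W : Type*} [AddCommGroup V] [AddCommGroup W] (L : AddSubgroup V)
  (χ : AddChar W (AddChar V Circle)) (h : ∀ w, ∀ x ∈ L, χ w x = 1)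

/-- The characters of the quotient `V ⧸ L` induced by characters of `V` that are trivial on `L`. -/
def liftCharacters : AddChar W (AddChar (V ⧸ L) Circle) where
  toFun w :=
    { toFun := Quotient.lift (χ w) fun a b hab => by
        have h' := h w _ (QuotientAddGroup.leftRel_apply.1 hab)
        rw [← add_neg_cancel_left a b, AddChar.map_add_eq_mul, h', mul_one]
      map_zero_eq_one' := (χ w).map_zero_eq_one
      map_add_eq_mul' := fun x y => by
        induction x using QuotientAddGroup.induction_on with | _ x
        induction y using QuotientAddGroup.induction_on with | _ y
        exact (χ w).map_add_eq_mul x y }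
  map_zero_eq_one' := by
    ext x
    induction x using QuotientAddGroup.induction_on with | _ x
    exact congrArg (fun ψ : AddChar V Circle => (ψ x : ℂ)) χ.map_zero_eq_one
  map_add_eq_mul' w w' := by
    ext x
    induction x using QuotientAddGroup.induction_on with | _ x
    exact congrArg (fun ψ : AddChar V Circle => (ψ x : ℂ)) (χ.map_add_eq_mul w w')

theorem isPontryaginDual_liftCharacters [TopologicalSpace V] (hcont : ∀ w, Continuous (χ w))
    (hinj : Function.Injective χ) (hsep : ∀ x, (∀ w, χ w x = 1) → x ∈ L) :
    IsPontryaginDual (liftCharacters L χ h) where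
  continuous w := (hcont w).quotient_lift _
  injective w w' hw := hinj <| by
    ext x
    exact congrArg (fun ψ : AddChar (V ⧸ L) Circle => (ψ x : ℂ)) hw
  separates x hx := by
    induction x using QuotientAddGroup.induction_on with | _ x
    exact (QuotientAddGroup.eq_zero_iff x).2 (hsep x hx)

end LiftCharacter

section Unfolding

theorem isAddFundamentalDomain_op {V : Type*} [AddCommGroup V] [MeasurableSpace V]
    {L : AddSubgroup V} {ν : Measure V} {s : Set V} (hs : IsAddFundamentalDomain L s ν) :
    IsAddFundamentalDomain L.op s ν :=
  hs.preimage_of_equiv (.id ν) (AddSubgroup.equivOp L).bijective fun g x => add_comm x (g : V)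

variable {V W : Type*} [AddCommGroup V] [TopologicalSpace V] {L : AddSubgroup V} {u : V → ℝ}

/-- The translates of `u` by the elements of `L` have a sum, and this sum is continuous. -/
structure IsPeriodizable (L : AddSubgroup V) (u : V → ℝ) : Prop where
  summable : ∀ x, Summable fun y : L => u (x + y)
  continuous : Continuous fun x => ∑' y : L, u (x + y)

theorem IsPeriodizable.tsum_pos (hu : IsPeriodizable L u) (hpos : ∀ x, 0 < u x) (x : V) :
    0 < ∑' y : L, u (x + y) :=
  (hu.summable x).tsum_pos (fun _ => (hpos _).le) 0 (hpos _)

variable [IsTopologicalAddGroup V] [MeasurableSpace V] [BorelSpace V] [Countable L]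

section QuotientFun

variable [T1Space V]

theorem IsPeriodizable.quotientFun_mk (hu : IsPeriodizable L u) (x : V) :
    quotientFun L Measure.count u (x : V ⧸ L) = (∑' y : L, u (x + y)) / ∑' y : L, u (0 + y) := by
  have h0 := integral_count_of_summable (hu.summable 0).norm
  simp only [zero_add] at h0 ⊢
  exact congrArg₂ (· / ·) (integral_count_of_summable (hu.summable x).norm) h0

theorem IsPeriodizable.continuous_quotientFun (hu : IsPeriodizable L u) :
    Continuous (quotientFun L Measure.count u) :=
  ((hu.continuous.div_const _).congr fun x => (hu.quotientFun_mk x).symm).quotient_lift _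

theorem IsPeriodizable.quotientFun_pos (hu : IsPeriodizable L u) (hpos : ∀ x, 0 < u x)
    (x : V ⧸ L) : 0 < quotientFun L Measure.count u x := by
  induction x using QuotientAddGroup.induction_on with | _ x
  rw [hu.quotientFun_mk]
  exact div_pos (hu.tsum_pos hpos x) (hu.tsum_pos hpos 0)

theorem IsPeriodizable.quotientFun_zero (hu : IsPeriodizable L u) (hpos : ∀ x, 0 < u x) :
    quotientFun L Measure.count u 0 = 1 := by
  rw [← QuotientAddGroup.mk_zero, hu.quotientFun_mk, div_self (hu.tsum_pos hpos 0).ne']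

end QuotientFun

variable [PolishSpace V] [CompactSpace (V ⧸ L)] [T2Space (V ⧸ L)] {ν : Measure V}
  [ν.IsAddHaarMeasure] [SigmaFinite ν] {s : Set V}

theorem map_mk_restrict_fundamentalDomain (hs : IsAddFundamentalDomain L.op s ν) (hs' : ν s ≠ ⊤) :
    (ν.restrict s).map (QuotientAddGroup.mk : V → V ⧸ L) = ν s • haarProb (V ⧸ L) := by
  have hμ := IsFundamentalDomain.AddQuotientMeasureEqMeasurePreimage_vaddAddHaarMeasure ν ⊤ hs hs'
  exact (hμ.addProjection_respects_measure' s hs).symm.trans (by simp [haarProb])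

theorem integral_mul_periodization (hs : IsAddFundamentalDomain L.op s ν) (hs' : ν s ≠ ⊤)
    {f : V → ℂ} (hf : Integrable f ν) {g S : V ⧸ L → ℂ} (hg : Continuous g) (hS : Continuous S)
    (hfS : ∀ x : V, S x = ∑' y : L, f (x + y)) :
    (ν.real s : ℂ) * ∫ x, g x * S x ∂haarProb (V ⧸ L) = ∫ x : V, g (x : V ⧸ L) * f x ∂ν := by
  have hA : QuotientAddGroup.automorphize f = S := by
    funext x
    induction x using QuotientAddGroup.induction_on with | _ x
    rw [hfS]
    exact (AddSubgroup.equivOp L).symm.tsum_eq fun y : L => f (x + y)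
  obtain ⟨C, hC⟩ := (isCompact_range hg.norm).bddAbove
  have hgC : ∀ x, ‖g x‖ₑ ≤ ENNReal.ofReal C := fun x =>
    (ofReal_norm (g x)).symm.le.trans (ENNReal.ofReal_le_ofReal (hC ⟨x, rfl⟩))
  rw [QuotientAddGroup.integral_mul_eq_integral_automorphize_mul hs hf hg.aestronglyMeasurable
    (ne_top_of_le_ne_top ENNReal.ofReal_ne_top (essSup_le_of_ae_le _ (.of_forall hgC)))
    (hA ▸ hS.aestronglyMeasurable), hA, map_mk_restrict_fundamentalDomain hs hs',
    integral_smul_measure, Complex.real_smul]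
  rfl

theorem IsPeriodizable.integral_mul_quotientFun (hu : IsPeriodizable L u)
    (hs : IsAddFundamentalDomain L.op s ν) (hs' : ν s ≠ ⊤) (hpos : ∀ x, 0 < u x)
    (hint : Integrable u ν) {g : V ⧸ L → ℂ} (hg : Continuous g) :
    (ν.real s * ∑' y : L, u (0 + y) : ℝ) *
        ∫ x, g x * quotientFun L Measure.count u x ∂haarProb (V ⧸ L) =
      ∫ x : V, g (x : V ⧸ L) * u x ∂ν := by
  have hv := hu.continuous_quotientFun
  have h := integral_mul_periodization hs hs' (f := fun x => (u x : ℂ)) hint.ofReal hg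
    (S := fun x => ((∑' y : L, u (0 + y) : ℝ) : ℂ) * quotientFun L Measure.count u x)
    (by fun_prop) fun x => by
      rw [hu.quotientFun_mk, ← Complex.ofReal_mul, mul_div_cancel₀ _ (hu.tsum_pos hpos 0).ne',
        Complex.ofReal_tsum]
  rw [← h, Complex.ofReal_mul, mul_assoc, ← integral_const_mul]
  congr with x
  ring

theorem IsPeriodizable.isFourierDual_quotientFun [AddCommGroup W] (hu : IsPeriodizable L u)
    (hs : IsAddFundamentalDomain L.op s ν) (hs' : ν s ≠ ⊤) (hpos : ∀ x, 0 < u x)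
    (hint : Integrable u ν) {χ : AddChar W (AddChar V Circle)} (hχ : ∀ w, Continuous (χ w))
    (h : ∀ w, ∀ x ∈ L, χ w x = 1) {p : W → ℝ} (hp : ∀ w, 0 ≤ p w) (hsum : Summable p)
    (hpu : ∀ w, ∫ x, (χ (-w) x : ℂ) * u x ∂ν = p w * ∫ x, u x ∂ν) :
    IsFourierDual (liftCharacters L χ h) (quotientFun L Measure.count u) p := by
  have hc : ((ν.real s * ∑' y : L, u (0 + y) : ℝ) : ℂ) ≠ 0 :=
    Complex.ofReal_ne_zero.2 (mul_ne_zero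
      (ENNReal.toReal_ne_zero.2 ⟨hs.measure_ne_zero (NeZero.ne ν), hs'⟩) (hu.tsum_pos hpos 0).ne')
  refine ⟨hp, hsum, fun w => mul_left_cancel₀ hc ?_⟩
  have h1 := hu.integral_mul_quotientFun hs hs' hpos hint (g := fun _ => 1) continuous_const
  simp only [one_mul, integral_complex_ofReal] at h1
  have hχw : Continuous fun x => (liftCharacters L χ h (-w) x : ℂ) :=
    continuous_subtype_val.comp ((hχ (-w)).quotient_lift _)
  rw [fourierCoefficient, hu.integral_mul_quotientFun hs hs' hpos hint hχw, mul_left_comm, h1]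
  exact hpu w

end Unfolding

section PairingCharacter

theorem fourierChar_eq_one_iff {t : ℝ} : Real.fourierChar t = 1 ↔ t ∈ (1 : Submodule ℤ ℝ) := by
  have h : 2 * Real.pi ≠ 0 := by positivity
  simp only [Real.fourierChar_apply', Circle.exp_eq_one, mul_comm _ (2 * Real.pi),
    mul_right_inj' h, Submodule.mem_one, eq_intCast, eq_comm (a := t)]

variable {V : Type*} [AddCommGroup V] [Module ℝ V] (B : LinearMap.BilinForm ℝ V)

/-- The characters `x ↦ exp (2 π i B(w, x))` of a real vector space with a bilinear form `B`. -/
def pairingChar : AddChar V (AddChar V Circle) where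
  toFun w := Real.fourierChar.compAddMonoidHom (B w).toAddMonoidHom
  map_zero_eq_one' := by
    ext x
    simp
  map_add_eq_mul' w w' := by
    ext x
    simp [AddChar.map_add_eq_mul]

variable {B}

theorem pairingChar_apply (w x : V) : pairingChar B w x = Real.fourierChar (B w x) := rfl

theorem pairingChar_eq_one_iff {w x : V} :
    pairingChar B w x = 1 ↔ B w x ∈ (1 : Submodule ℤ ℝ) := fourierChar_eq_one_iff

theorem pairingChar_injective (hB : B.Nondegenerate) : Function.Injective (pairingChar B) := by
  rw [AddChar.injective_iff]
  intro w hw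
  refine hB.1 w fun x => ?_
  by_contra hne
  refine Real.fourierChar_ne_one (DFunLike.ext _ _ fun t => ?_)
  calc Real.fourierChar t = pairingChar B w ((t / B w x) • x) := by
        rw [pairingChar_apply, map_smul, smul_eq_mul, div_mul_cancel₀ _ hne]
    _ = 1 := by rw [hw, AddChar.one_apply]

theorem continuous_pairingChar [TopologicalSpace V] [IsTopologicalAddGroup V]
    [ContinuousSMul ℝ V] [T2Space V] [FiniteDimensional ℝ V] (w : V) :
    Continuous (pairingChar B w) :=
  Real.continuous_fourierChar.comp (B w).continuous_of_finiteDimensional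

/-- The characters of the quotient `V ⧸ L` defined by the elements of the dual lattice `W`. -/
def latticeChar {L W : Submodule ℤ V} (h : W = B.dualSubmodule L) :
    AddChar W.toAddSubgroup (AddChar (V ⧸ L.toAddSubgroup) Circle) :=
  liftCharacters L.toAddSubgroup ((pairingChar B).compAddMonoidHom W.toAddSubgroup.subtype)
    fun w x hx => pairingChar_eq_one_iff.2 (h.le w.2 x hx)

variable {V : Type*} [NormedAddCommGroup V] [NormedSpace ℝ V] [FiniteDimensional ℝ V]
  {B : LinearMap.BilinForm ℝ V} {L W : Submodule ℤ V} [DiscreteTopology L] [IsZLattice ℝ L]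

theorem dualSubmodule_dualSubmodule_of_isZLattice (hB : B.Nondegenerate) (hB' : B.IsSymm) :
    B.dualSubmodule (B.dualSubmodule L) = L := by
  have h := B.dualSubmodule_dualSubmodule_of_basis (R := ℤ) hB hB'
    ((Module.Free.chooseBasis ℤ L).ofZLatticeBasis ℝ L)
  rwa [Module.Basis.ofZLatticeBasis_span] at h

theorem isPontryaginDual_latticeChar (hB : B.Nondegenerate) (hB' : B.IsSymm)
    (h : W = B.dualSubmodule L) : IsPontryaginDual (latticeChar h) := by
  refine isPontryaginDual_liftCharacters _ _ _ (fun w => continuous_pairingChar _)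
    ((pairingChar_injective hB).comp Subtype.val_injective) fun x hx => ?_
  suffices x ∈ B.dualSubmodule (B.dualSubmodule L) by
    rwa [dualSubmodule_dualSubmodule_of_isZLattice hB hB'] at this
  intro w hw
  rw [hB'.eq]
  exact pairingChar_eq_one_iff.1 (hx ⟨w, h.ge hw⟩)

end PairingCharacter

section Gaussian

/-- The Gaussian function `exp (-π ‖x‖ ^ 2)`, normalized to be its own Fourier transform if `E` is
a euclidean space. -/
def normGaussian {E : Type*} [Norm E] (x : E) : ℝ := Real.exp (-Real.pi * ‖x‖ ^ 2)

section Seminormed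

variable {E : Type*} [SeminormedAddCommGroup E]

theorem continuous_normGaussian : Continuous (normGaussian : E → ℝ) := by
  unfold normGaussian
  fun_prop

theorem normGaussian_pos (x : E) : 0 < normGaussian x := Real.exp_pos _

theorem normGaussian_add_le (x y : E) :
    normGaussian (x + y) ≤
      Real.exp (Real.pi * ‖x‖ ^ 2) * Real.exp (-(Real.pi / 2) * ‖y‖ ^ 2) := by
  have h : ‖y‖ ≤ ‖x + y‖ + ‖x‖ := by simpa using norm_sub_le (x + y) x
  have h2 : ‖y‖ ^ 2 ≤ 2 * (‖x + y‖ ^ 2 + ‖x‖ ^ 2) :=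
    (pow_le_pow_left₀ (norm_nonneg y) h 2).trans add_sq_le
  rw [normGaussian, ← Real.exp_add, Real.exp_le_exp]
  nlinarith [Real.pi_pos]

end Seminormed

section Euclidean

variable {E : Type*} [NormedAddCommGroup E] [InnerProductSpace ℝ E]

theorem pairingChar_innerₗ_mul_normGaussian (w x : E) :
    (pairingChar (innerₗ E) w x : ℂ) * normGaussian x =
      Complex.exp (-Real.pi * ‖x‖ ^ 2 + 2 * Real.pi * Complex.I * inner ℝ w x) := by
  rw [pairingChar_apply, Real.fourierChar_apply, normGaussian, Complex.ofReal_exp,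
    ← Complex.exp_add, innerₗ_apply_apply]
  congr 1
  push_cast
  ring

variable [FiniteDimensional ℝ E] [MeasurableSpace E] [BorelSpace E]

theorem integrable_pairingChar_mul_normGaussian (w : E) :
    Integrable fun x => (pairingChar (innerₗ E) w x : ℂ) * normGaussian x := by
  simp only [pairingChar_innerₗ_mul_normGaussian]
  exact GaussianFourier.integrable_cexp_neg_mul_sq_norm_add
    (Complex.ofReal_re _ ▸ Real.pi_pos) _ _

theorem integral_pairingChar_mul_normGaussian (w : E) :
    ∫ x, (pairingChar (innerₗ E) w x : ℂ) * normGaussian x = normGaussian w := by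
  have hpi : (Real.pi : ℂ) ≠ 0 := Complex.ofReal_ne_zero.2 Real.pi_ne_zero
  simp only [pairingChar_innerₗ_mul_normGaussian]
  rw [GaussianFourier.integral_cexp_neg_mul_sq_norm_add (Complex.ofReal_re _ ▸ Real.pi_pos),
    div_self hpi, Complex.one_cpow, one_mul, normGaussian, Complex.ofReal_exp]
  congr 1
  push_cast
  field_simp
  linear_combination (4 * ‖w‖ ^ 2 : ℂ) * Complex.I_sq

theorem integrable_normGaussian : Integrable (normGaussian : E → ℝ) := by
  simpa using (integrable_pairingChar_mul_normGaussian (0 : E)).re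

theorem isFirstKind_normGaussian : IsFirstKind (normGaussian : E → ℝ) where
  pos := normGaussian_pos
  map_zero := by simp [normGaussian]
  continuous := continuous_normGaussian
  posDef := by
    have h : ∀ x : E, PosDefFun fun w => (pairingChar (innerₗ E) w x : ℂ) * normGaussian x := by
      intro x
      simpa only [pairingChar_apply, innerₗ_apply_apply, real_inner_comm, mul_comm] using
        (posDefFun_addChar (pairingChar (innerₗ E) x)).const_mul
          (Complex.zero_le_real.2 (normGaussian_pos x).le)
    simpa only [integral_pairingChar_mul_normGaussian] using
      PosDefFun.integral h integrable_pairingChar_mul_normGaussian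

end Euclidean

section Pullback

variable {V E : Type*} [NormedAddCommGroup V] [NormedSpace ℝ V] [FiniteDimensional ℝ V]
  [NormedAddCommGroup E]

theorem summable_exp_neg_mul_norm_sq (L : Submodule ℤ V) [DiscreteTopology L] {a : ℝ}
    (ha : 0 < a) : Summable fun y : L => Real.exp (-a * ‖(y : V)‖ ^ 2) := by
  obtain ⟨n, hn⟩ : ∃ n, Module.finrank ℤ L < 2 * n := ⟨Module.finrank ℤ L + 1, by omega⟩
  have hs : Summable fun y : L => (n.factorial / a ^ n : ℝ) * ‖y‖⁻¹ ^ (2 * n) :=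
    (ZLattice.summable_norm_pow_inv (L := L) (2 * n) hn).mul_left _
  refine Summable.of_norm_bounded_eventually hs ?_
  filter_upwards [(Set.finite_singleton (0 : L)).compl_mem_cofinite] with y hy0
  have hy1 : 0 < ‖y‖ := norm_pos_iff.2 hy0
  have hk : 0 < a * ‖y‖ ^ 2 := by positivity
  rw [Real.norm_of_nonneg (Real.exp_nonneg _), neg_mul, Real.exp_neg]
  calc (Real.exp (a * ‖y‖ ^ 2))⁻¹ ≤ ((a * ‖y‖ ^ 2) ^ n / n.factorial)⁻¹ :=
        inv_anti₀ (by positivity) (Real.pow_div_factorial_le_exp _ hk.le n)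
    _ = n.factorial / a ^ n * ‖y‖⁻¹ ^ (2 * n) := by
        rw [mul_pow, inv_pow, pow_mul, inv_div]
        field_simp

variable [NormedSpace ℝ E]

theorem summable_exp_neg_mul_norm_apply_sq (A : V ≃L[ℝ] E) (L : Submodule ℤ V)
    [DiscreteTopology L] {a : ℝ} (ha : 0 < a) :
    Summable fun y : L => Real.exp (-a * ‖A y‖ ^ 2) := by
  let K : ℝ := ‖(A.symm : E →L[ℝ] V)‖ + 1
  have hK : 0 < K := by positivity
  have h : ∀ z, ‖z‖ ≤ K * ‖A z‖ := fun z => calc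
    ‖z‖ = ‖(A.symm : E →L[ℝ] V) (A z)‖ := by simp
    _ ≤ ‖(A.symm : E →L[ℝ] V)‖ * ‖A z‖ := ContinuousLinearMap.le_opNorm _ _
    _ ≤ K * ‖A z‖ := by gcongr; exact le_add_of_nonneg_right zero_le_one
  refine Summable.of_nonneg_of_le (fun _ => Real.exp_nonneg _) (fun y => ?_)
    (summable_exp_neg_mul_norm_sq L (div_pos ha (pow_pos hK 2)))
  rw [Real.exp_le_exp, neg_mul, neg_mul, neg_le_neg_iff, div_mul_eq_mul_div, mul_div_assoc]
  refine mul_le_mul_of_nonneg_left ?_ ha.le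
  rw [div_le_iff₀' (pow_pos hK 2), ← mul_pow]
  exact pow_le_pow_left₀ (norm_nonneg _) (h y) 2

theorem isPeriodizable_normGaussian (A : V ≃L[ℝ] E) (L : Submodule ℤ V) [DiscreteTopology L] :
    IsPeriodizable L.toAddSubgroup fun z => normGaussian (A z) := by
  have hs := summable_exp_neg_mul_norm_apply_sq A L (half_pos Real.pi_pos)
  have hle : ∀ (x : V) (y : L), normGaussian (A (x + y)) ≤
      Real.exp (Real.pi * ‖A x‖ ^ 2) * Real.exp (-(Real.pi / 2) * ‖A y‖ ^ 2) := fun x y => by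
    rw [map_add]
    exact normGaussian_add_le _ _
  refine ⟨fun x => Summable.of_nonneg_of_le (fun _ => (normGaussian_pos _).le) (hle x)
    (hs.mul_left _), continuous_iff_continuousAt.2 fun x => ?_⟩
  have hU : {z | ‖A z‖ ^ 2 < ‖A x‖ ^ 2 + 1} ∈ nhds x :=
    (isOpen_lt (by fun_prop) continuous_const).mem_nhds (lt_add_one (‖A x‖ ^ 2))
  refine ContinuousOn.continuousAt (continuousOn_tsum (fun y => ?_)
    (hs.mul_left (Real.exp (Real.pi * (‖A x‖ ^ 2 + 1)))) fun y z hz => ?_) hU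
  · exact (continuous_normGaussian.comp (A.continuous.comp (continuous_add_const _))).continuousOn
  · rw [Real.norm_of_nonneg (normGaussian_pos _).le]
    refine (hle z y).trans (mul_le_mul_of_nonneg_right ?_ (Real.exp_nonneg _))
    exact Real.exp_le_exp.2 (mul_le_mul_of_nonneg_left hz.le Real.pi_pos.le)

end Pullback

section PullbackEuclidean

variable {V E : Type*} [NormedAddCommGroup V] [NormedSpace ℝ V] [MeasurableSpace V] [BorelSpace V]
  {ν : Measure V} [ν.IsAddHaarMeasure] [NormedAddCommGroup E] [InnerProductSpace ℝ E]
  [FiniteDimensional ℝ E] [MeasurableSpace E] [BorelSpace E]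

theorem exists_map_eq_smul_volume (A : V ≃L[ℝ] E) : ∃ c : NNReal, ν.map A = c • volume := by
  have := A.isAddHaarMeasure_map ν
  exact ⟨_, Measure.isAddLeftInvariant_eq_smul _ _⟩

theorem integrable_normGaussian_comp (A : V ≃L[ℝ] E) :
    Integrable (fun z => normGaussian (A z)) ν := by
  have hA : MeasurableEmbedding A := A.toHomeomorph.measurableEmbedding
  obtain ⟨c, hc⟩ := exists_map_eq_smul_volume (ν := ν) A
  exact hA.integrable_map_iff.1 (hc ▸ integrable_normGaussian.smul_measure_nnreal)

theorem integral_pairingChar_mul_normGaussian_comp (A : V ≃L[ℝ] E) (w : E) :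
    ∫ z, (pairingChar (innerₗ E) w (A z) : ℂ) * normGaussian (A z) ∂ν =
      normGaussian w * ∫ z, normGaussian (A z) ∂ν := by
  have hA : MeasurableEmbedding A := A.toHomeomorph.measurableEmbedding
  obtain ⟨c, hc⟩ := exists_map_eq_smul_volume (ν := ν) A
  have key : ∀ w : E, ∫ z, (pairingChar (innerₗ E) w (A z) : ℂ) * normGaussian (A z) ∂ν =
      c • (normGaussian w : ℂ) := fun w => by
    rw [← hA.integral_map fun x => (pairingChar (innerₗ E) w x : ℂ) * normGaussian x, hc,
      integral_smul_nnreal_measure, integral_pairingChar_mul_normGaussian]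
  have h0 : ((∫ z, normGaussian (A z) ∂ν : ℝ) : ℂ) = c • (1 : ℂ) := by
    rw [← integral_complex_ofReal]
    simpa [normGaussian] using key 0
  rw [key, h0, mul_smul_comm, mul_one]

end PullbackEuclidean

end Gaussian

end Ghost

namespace ArakelovDivisor

open Ghost mixedEmbedding

variable {F : Type*} [Field F] [NumberField F]

section Pairing

open scoped Classical in
/-- The `ℝ`-bilinear extension to `F ⊗ ℝ` of the trace form `(a, b) ↦ Tr (a b)` of `F`; each
complex place contributes twice a real part, for its two complex embeddings. -/
def pairing : LinearMap.BilinForm ℝ (mixedSpace F) :=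
  LinearMap.mk₂ ℝ (fun w z => ∑ σ, w.1 σ * z.1 σ + ∑ σ, 2 * (w.2 σ * z.2 σ).re)
    (fun w w' z => by simp [add_mul, mul_add, Finset.sum_add_distrib, add_add_add_comm])
    (fun t w z => by simp [mul_assoc, mul_left_comm _ t, Finset.mul_sum, mul_add, mul_sub])
    (fun w z z' => by simp [mul_add, Finset.sum_add_distrib, add_add_add_comm])
    (fun t w z => by simp [mul_left_comm _ t, Finset.mul_sum, mul_add, mul_sub])

open scoped Classical in
theorem pairing_apply (w z : mixedSpace F) :
    pairing w z = ∑ σ, w.1 σ * z.1 σ + ∑ σ, 2 * (w.2 σ * z.2 σ).re := rfl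

theorem pairing_isSymm : (pairing (F := F)).IsSymm :=
  ⟨fun w z => by simp only [pairing_apply, mul_comm]⟩

theorem pairing_nondegenerate : (pairing (F := F)).Nondegenerate := by
  classical
  refine pairing_isSymm.isRefl.nondegenerate_iff_separatingLeft.2 fun w h => ?_
  have h := h (star w)
  simp only [pairing_apply, Prod.fst_star, Prod.snd_star, Pi.star_apply, star_trivial,
    RCLike.star_def, Complex.mul_conj, Complex.ofReal_re] at h
  have h₁ : ∀ σ ∈ Finset.univ, 0 ≤ w.1 σ * w.1 σ := fun σ _ => mul_self_nonneg _
  have h₂ : ∀ σ ∈ Finset.univ, 0 ≤ 2 * Complex.normSq (w.2 σ) :=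
    fun σ _ => mul_nonneg zero_le_two (Complex.normSq_nonneg _)
  rw [add_eq_zero_iff_of_nonneg (Finset.sum_nonneg h₁) (Finset.sum_nonneg h₂),
    Finset.sum_eq_zero_iff_of_nonneg h₁, Finset.sum_eq_zero_iff_of_nonneg h₂] at h
  refine Prod.ext (funext fun σ => ?_) (funext fun σ => ?_)
  · simpa using h.1 σ (Finset.mem_univ _)
  · simpa using h.2 σ (Finset.mem_univ _)

theorem pairing_mixedEmbedding (a b : F) :
    pairing (mixedEmbedding F a) (mixedEmbedding F b) = Algebra.traceForm ℚ F a b := by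
  classical
  have h := trace_eq_sum_embeddings ℂ (K := ℚ) (L := F) (x := a * b)
  have h' : ∑ σ : F →ₐ[ℚ] ℂ, σ (a * b) = ∑ φ : F →+* ℂ, φ (a * b) :=
    Fintype.sum_equiv (RingHom.equivRatAlgHom F ℂ).symm _ _ fun σ => rfl
  rw [h', ← (indexEquiv F).sum_comp, Fintype.sum_sum_type, Fintype.sum_prod_type] at h
  simp only [Fin.sum_univ_two, indexEquiv_apply_isReal, indexEquiv_apply_isComplex_fst,
    indexEquiv_apply_isComplex_snd, ComplexEmbedding.conjugate_coe_eq, Complex.add_conj,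
    eq_ratCast] at h
  rw [← Complex.ofReal_inj, pairing_apply, Algebra.traceForm_apply, Complex.ofReal_ratCast, h]
  push_cast
  congr 1 <;> refine Finset.sum_congr rfl fun σ _ => ?_
  · simp [mixedEmbedding_apply_isReal]
  · simp [mixedEmbedding_apply_isComplex]

end Pairing

section Duality

theorem span_basisOfFractionalIdeal (I : (FractionalIdeal (𝓞 F)⁰ F)ˣ) :
    Submodule.span ℤ (Set.range (basisOfFractionalIdeal F I)) =
      ((I : FractionalIdeal (𝓞 F)⁰ F) : Submodule (𝓞 F) F).restrictScalars ℤ :=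
  Submodule.ext fun _ => mem_span_basisOfFractionalIdeal F

theorem idealLattice_eq_map (I : (FractionalIdeal (𝓞 F)⁰ F)ˣ) :
    idealLattice F I = (((I : FractionalIdeal (𝓞 F)⁰ F) : Submodule (𝓞 F) F).restrictScalars
      ℤ).map (mixedEmbedding F).toIntAlgHom.toLinearMap :=
  Submodule.ext fun _ => mem_idealLattice F I

theorem dualBasis_fractionalIdealLatticeBasis (I : (FractionalIdeal (𝓞 F)⁰ F)ˣ)
    [DecidableEq (Module.Free.ChooseBasisIndex ℤ I)] :
    ⇑(pairing.dualBasis pairing_nondegenerate (fractionalIdealLatticeBasis F I)) =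
      mixedEmbedding F ∘ (basisOfFractionalIdeal F I).traceDual := by
  rw [LinearMap.BilinForm.dualBasis_eq_iff]
  intro i j
  rw [fractionalIdealLatticeBasis_apply, Function.comp_apply, pairing_mixedEmbedding,
    Module.Basis.traceDual, LinearMap.BilinForm.apply_dualBasis_left]
  split_ifs <;> simp

theorem idealLattice_eq_dualSubmodule {I J : (FractionalIdeal (𝓞 F)⁰ F)ˣ}
    (h : (J : FractionalIdeal (𝓞 F)⁰ F) = FractionalIdeal.dual ℤ ℚ I) :
    idealLattice F J = pairing.dualSubmodule (idealLattice F I) := by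
  classical
  rw [← span_idealLatticeBasis F I,
    LinearMap.BilinForm.dualSubmodule_span_of_basis _ pairing_nondegenerate,
    dualBasis_fractionalIdealLatticeBasis, Set.range_comp, idealLattice_eq_map, h,
    FractionalIdeal.coe_dual _ _ I.ne_zero, Submodule.traceDual_span_of_basis ℤ _ _
      (span_basisOfFractionalIdeal I).symm, Submodule.map_span]
  rfl

theorem ideal_add (D E : ArakelovDivisor F) : (D + E).ideal = D.ideal * E.ideal :=
  Finsupp.prod_add_index' (fun P => by simp) fun P m n => by rw [neg_add, zpow_add]

theorem ideal_canonical_sub (D : ArakelovDivisor F) :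
    ((canonical F - D).ideal : FractionalIdeal (𝓞 F)⁰ F) =
      FractionalIdeal.dual ℤ ℚ (D.ideal : FractionalIdeal (𝓞 F)⁰ F) := by
  have h : (canonical F - D).ideal = (canonical F).ideal * D.ideal⁻¹ := by
    rw [eq_mul_inv_iff_mul_eq, ← ideal_add, sub_add_cancel]
  rw [h, FractionalIdeal.dual_eq_mul_inv, Units.val_mul, ideal_canonical,
    coeIdeal_differentIdeal ℤ ℚ F (𝓞 F), inv_inv, Units.val_inv_eq_inv_val]

theorem idealLattice_canonical_sub (D : ArakelovDivisor F) :
    idealLattice F (canonical F - D).ideal = pairing.dualSubmodule (idealLattice F D.ideal) :=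
  idealLattice_eq_dualSubmodule D.ideal_canonical_sub

end Duality

variable (D : ArakelovDivisor F)

section Gaussian

/-- `F ⊗ ℝ` with the hermitian norm `‖z‖_D`, as the standard euclidean space: the coordinates are
scaled by the square roots of the weights in `normSq`. -/
def toEuclidean : mixedSpace F ≃L[ℝ] euclidean.mixedSpace F :=
  ((ContinuousLinearEquiv.piCongrRight fun σ : {σ : InfinitePlace F // σ.IsReal} =>
    ContinuousLinearEquiv.smulLeft <|
      Units.mk0 (Real.exp (-D.2 σ)) (Real.exp_ne_zero _)).prodCongr
    (ContinuousLinearEquiv.piCongrRight fun σ : {σ : InfinitePlace F // σ.IsComplex} =>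
      ContinuousLinearEquiv.smulLeft <|
        Units.mk0 √(2 * Real.exp (-D.2 σ)) (by positivity))).trans (euclidean.toMixed F).symm

theorem toEuclidean_fst (z : mixedSpace F) (σ : {σ : InfinitePlace F // σ.IsReal}) :
    (D.toEuclidean z).fst σ = Real.exp (-D.2 σ) * z.1 σ := rfl

theorem toEuclidean_snd (z : mixedSpace F) (σ : {σ : InfinitePlace F // σ.IsComplex}) :
    (D.toEuclidean z).snd σ = √(2 * Real.exp (-D.2 σ)) * z.2 σ := Complex.real_smul

open scoped Classical in
theorem norm_toEuclidean_sq (z : mixedSpace F) : ‖D.toEuclidean z‖ ^ 2 = D.normSq z := by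
  simp only [WithLp.prod_norm_sq_eq_of_L2, EuclideanSpace.norm_sq_eq, normSq, toEuclidean_fst,
    toEuclidean_snd, norm_mul, mul_pow, Real.norm_eq_abs, Complex.norm_real, sq_abs]
  congr 1 <;> refine Finset.sum_congr rfl fun σ _ => ?_
  · rw [← Real.exp_nat_mul, mul_comm, Nat.cast_ofNat, mul_neg, neg_mul]
  · rw [Real.sq_sqrt (by positivity), mul_comm]

open scoped Classical in
theorem gaussian_eq_normGaussian (z : mixedSpace F) :
    D.gaussian z = normGaussian (D.toEuclidean z) := by
  rw [gaussian, normGaussian, norm_toEuclidean_sq]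

theorem normSq_star (z : mixedSpace F) : D.normSq (star z) = D.normSq z := by
  simp [normSq]

open scoped Classical in
theorem inner_toEuclidean_star {D E : ArakelovDivisor F} (h : E.2 = -D.2) (w z : mixedSpace F) :
    inner ℝ (E.toEuclidean (star w)) (D.toEuclidean z) = pairing w z := by
  have hsq : ∀ t : ℝ, √(2 * Real.exp (-t)) * √(2 * Real.exp t) = 2 := fun t => by
    rw [← Real.sqrt_mul (by positivity), mul_mul_mul_comm, ← Real.exp_add, neg_add_cancel,
      Real.exp_zero, mul_one, Real.sqrt_mul_self zero_le_two]
  rw [WithLp.prod_inner_apply, PiLp.inner_apply, PiLp.inner_apply, pairing_apply]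
  congr 1 <;> refine Finset.sum_congr rfl fun σ _ => ?_
  · refine (congrArg₂ (inner ℝ) (E.toEuclidean_fst _ σ) (D.toEuclidean_fst z σ)).trans ?_
    rw [h, Pi.neg_apply, neg_neg, RCLike.inner_apply', conj_trivial, mul_mul_mul_comm,
      ← Real.exp_add, add_neg_cancel, Real.exp_zero, one_mul, Prod.fst_star, Pi.star_apply,
      star_trivial]
  · refine (congrArg₂ (inner ℝ) (E.toEuclidean_snd _ σ) (D.toEuclidean_snd z σ)).trans ?_
    rw [h, Pi.neg_apply, neg_neg, Complex.inner, map_mul, Complex.conj_ofReal, mul_mul_mul_comm,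
      ← Complex.ofReal_mul, hsq, Complex.re_ofReal_mul, mul_comm (z.2 σ), Prod.snd_star,
      Pi.star_apply, RCLike.star_def, Complex.conj_conj]

theorem integral_pairingChar_mul_gaussian {D E : ArakelovDivisor F} (h : E.2 = -D.2)
    (ν : Measure (mixedSpace F)) [ν.IsAddHaarMeasure] (w : mixedSpace F) :
    ∫ z, (pairingChar pairing w z : ℂ) * D.gaussian z ∂ν =
      E.gaussian w * ∫ z, D.gaussian z ∂ν := by
  classical
  have hw : normGaussian (E.toEuclidean (star w)) = E.gaussian w := by
    rw [← gaussian_eq_normGaussian, gaussian, normSq_star, gaussian]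
  simp only [gaussian_eq_normGaussian D, ← hw, ← integral_pairingChar_mul_normGaussian_comp,
    pairingChar_apply, innerₗ_apply_apply, inner_toEuclidean_star h]

theorem integrable_gaussian (ν : Measure (mixedSpace F)) [ν.IsAddHaarMeasure] :
    Integrable D.gaussian ν := by
  classical
  rw [funext D.gaussian_eq_normGaussian]
  exact integrable_normGaussian_comp D.toEuclidean

theorem isFirstKind_gaussian : IsFirstKind D.gaussian := by
  classical
  rw [funext D.gaussian_eq_normGaussian]
  exact isFirstKind_normGaussian.comp (D.toEuclidean : mixedSpace F →+ euclidean.mixedSpace F)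
    D.toEuclidean.continuous

end Gaussian

section Cohomology

instance : Countable D.lattice := by
  classical
  exact inferInstanceAs (Countable (idealLattice F D.ideal))

open scoped Classical in
theorem isAddFundamentalDomain_lattice (ν : Measure (mixedSpace F)) :
    IsAddFundamentalDomain D.lattice
      (ZSpan.fundamentalDomain (fractionalIdealLatticeBasis F D.ideal)) ν := by
  rw [lattice, ← span_idealLatticeBasis]
  exact ZSpan.isAddFundamentalDomain' _ ν

theorem isPeriodizable_gaussian : IsPeriodizable D.lattice D.gaussian := by
  classical
  rw [funext D.gaussian_eq_normGaussian]
  exact isPeriodizable_normGaussian D.toEuclidean (idealLattice F D.ideal)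

theorem summable_H0 : Summable D.H0 := by
  have h := D.isPeriodizable_gaussian.summable 0
  simp only [zero_add] at h
  exact h

theorem isFirstKind_H0 : IsFirstKind D.H0 :=
  D.isFirstKind_gaussian.comp D.lattice.subtype continuous_subtype_val

theorem finiteDimFirst_H0 : FiniteDimFirst Measure.count D.H0 :=
  ⟨D.isFirstKind_H0.continuous.aestronglyMeasurable,
    hasFiniteIntegral_count_iff.2 D.summable_H0.norm⟩

theorem isPontryaginDual_lattice : IsPontryaginDual (latticeChar D.idealLattice_canonical_sub) := by
  classical
  exact isPontryaginDual_latticeChar pairing_nondegenerate pairing_isSymm _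

theorem isFourierDual_cechQuotient :
    IsFourierDual (latticeChar D.idealLattice_canonical_sub) D.cechQuotient
      (canonical F - D).H0 := by
  classical
  have hneg : (canonical F - D).2 = -D.2 := zero_sub _
  have hs := D.isAddFundamentalDomain_lattice volume
  refine D.isPeriodizable_gaussian.isFourierDual_quotientFun
    (χ := (pairingChar pairing).compAddMonoidHom (canonical F - D).lattice.subtype)
    (isAddFundamentalDomain_op hs) (ZSpan.fundamentalDomain_isBounded _).measure_lt_top.ne
    D.isFirstKind_gaussian.pos (D.integrable_gaussian volume)
    (fun _ => continuous_pairingChar _) _ (fun w => ((canonical F - D).isFirstKind_H0.pos w).le)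
    (canonical F - D).summable_H0 fun w => ?_
  rw [← (canonical F - D).isFirstKind_H0.apply_neg]
  exact integral_pairingChar_mul_gaussian hneg volume _

theorem isFirstKind_cechQuotient : IsFirstKind D.cechQuotient :=
  D.isFourierDual_cechQuotient.isFirstKind D.isPontryaginDual_lattice
    D.isPeriodizable_gaussian.continuous_quotientFun
    (D.isPeriodizable_gaussian.quotientFun_pos D.isFirstKind_gaussian.pos)
    (D.isPeriodizable_gaussian.quotientFun_zero D.isFirstKind_gaussian.pos)

theorem isSecondKind_H1 : IsSecondKind D.H1 :=
  D.isFourierDual_cechQuotient.isSecondKind_quotientMeasure D.isPontryaginDual_lattice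
    D.isFirstKind_cechQuotient

theorem finiteDimSecond_H1 : FiniteDimSecond (haarProb _) D.H1 :=
  D.isFirstKind_cechQuotient.finiteDimSecond_quotientMeasure
    (finiteDimFirst_haarProb D.isFirstKind_cechQuotient.continuous)

theorem h1_eq_h0 : D.h1 = (canonical F - D).h0 :=
  D.isFourierDual_cechQuotient.absDimSecond_quotientMeasure D.isPontryaginDual_lattice
    D.isFirstKind_cechQuotient

end Cohomology

end ArakelovDivisor

end

theorem corollary5p1 (F : Type*) [Field F] [NumberField F] (D : ArakelovDivisor F) :
    -- `H⁰(K - D)` is a finite-dimensional ghost-space of the first kind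
    Ghost.IsFirstKind (ArakelovDivisor.canonical F - D).H0 ∧
    Ghost.FiniteDimFirst MeasureTheory.Measure.count (ArakelovDivisor.canonical F - D).H0 ∧
    -- the ghost-spaces of the first kind from which `H¹(D)` is built are well-defined
    Ghost.IsFirstKind D.gaussian ∧
    Ghost.IsFirstKind D.H0 ∧
    Ghost.FiniteDimFirst MeasureTheory.Measure.count D.H0 ∧
    Ghost.IsFirstKind D.cechQuotient ∧
    -- `H¹(D)` is a finite-dimensional ghost-space of the second kind
    Ghost.IsSecondKind D.H1 ∧
    Ghost.FiniteDimSecond (Ghost.haarProb _) D.H1 ∧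
    -- the equality of dimensions
    D.h1 = (ArakelovDivisor.canonical F - D).h0 :=
  ⟨(ArakelovDivisor.canonical F - D).isFirstKind_H0,
    (ArakelovDivisor.canonical F - D).finiteDimFirst_H0, D.isFirstKind_gaussian, D.isFirstKind_H0,
    D.finiteDimFirst_H0, D.isFirstKind_cechQuotient, D.isSecondKind_H1, D.finiteDimSecond_H1,
    D.h1_eq_h0⟩
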